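/- For a finite sequence of positive integers $\mathbf{s}=(s_1,\dots,s_l)$, with $l=0$ or $s_l>1$, let $$t(s_1,\dots,s_l)=\sum_{1\le k_1<k_2<\cdots<k_l}\frac{1}{(2k_1-1)^{s_1}(2k_2-1)^{s_2}\cdots(2k_l-1)^{s_l}}$$ be the multiple $t$-value, where $t(\emptyset)=1$ for the empty sequence, and let $\{2\}^d$ denote the sequence consisting of $d$ entries equal to $2$. Let $\zeta$ be the Riemann zeta function. For all integers $r,s\ge 0$ put $T(r,s)=t(\{2\}^r,3,\{2\}^s)$, and for $k\ge 1$ put $$d^{(k)}_{r,s}=\binom{2k}{2r+1}+\Bigl(1-\frac{1}{2^{2k}}\Bigr)\binom{2k}{2s+1}.$$ Then for all integers $r,s\ge 0$ the series defining $T(r,s)$ and $t(\{2\}^{r+s+1-k})$, $1\le k\le r+s+1$, converge, and $$T(r,s)=\sum_{k=1}^{r+s+1}(-1)^{k-1}\,d^{(k)}_{r,s}\,\frac{1}{2^{2k}}\,\zeta(2k+1)\,t\bigl(\{2\}^{r+s+1-k}\bigr).$$ -/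

import Mathlib

/-- The range of summation of a multiple `t`-value of depth `l`:
tuples of integers with `1 ≤ k₁ < k₂ < ⋯ < k_l`. -/
def IncreasingTuple (l : ℕ) : Type :=
  {k : Fin l → ℕ // (∀ i, 1 ≤ k i) ∧ StrictMono k}

/-- The summand `1 / ((2k₁-1)^{s₁} ⋯ (2k_l-1)^{s_l})`, for an index `s = (s₁, …, s_l)`. -/
noncomputable def tTerm (s : List ℕ) (k : IncreasingTuple s.length) : ℝ :=
  ∏ i : Fin s.length, 1 / (2 * (k.1 i : ℝ) - 1) ^ s.get i

/-- The multiple `t`-value `t(s₁, …, s_l)`. For the empty index the sum has exactly one term,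
the empty product, so that `t(∅) = 1`. -/
noncomputable def multipleT (s : List ℕ) : ℝ :=
  ∑' k : IncreasingTuple s.length, tTerm s k

/-- The index `{2}^d`. -/
def twos (d : ℕ) : List ℕ := List.replicate d 2

/-- The index `({2}^r, 3, {2}^s)`. -/
def twosThreeTwos (r s : ℕ) : List ℕ := twos r ++ 3 :: twos s

/-- `T(r,s) = t({2}^r, 3, {2}^s)`. -/
noncomputable def T (r s : ℕ) : ℝ := multipleT (twosThreeTwos r s)

/-- The coefficient `d^{(k)}_{r,s}`. -/
noncomputable def dCoeff (k r s : ℕ) : ℝ :=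
  (Nat.choose (2 * k) (2 * r + 1) : ℝ)
    + (1 - 1 / 2 ^ (2 * k)) * (Nat.choose (2 * k) (2 * s + 1) : ℝ)

/-!
For `N ≥ 1` let `μ_N` be the probability measure on `[0, π/2]` proportional to `cos ^ (2N-1)`, and
let `μ_0` be the Dirac mass at `π/2`. Two integrations by parts give
`μ_N(p) - μ_{N+1}(p) = μ_{N+1}(p'') / (2N+1)^2` whenever `p(0) = p'(0) = 0`, and `μ_N` tends to the
Dirac mass at `0`. Telescoping therefore turns every entry `2` of a multiple `t`-value into a double
integration: the tail of `t({2}^d)` over `N < k₁ < ⋯ < k_d` is `μ_N(t^(2d) / (2d)!)`, so that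
`t({2}^d) = (π/2)^(2d) / (2d)!`. For the entry `3` one more integration by parts replaces the extra
factor `1 / (2k-1)` by a tangent, and in the end
`T(r,s) = ∫_0^{π/2} u^(2s+1) / (2s+1)! * (π/2 - u)^(2r+1) / (2r+1)! * tan u du`.

Now insert the divergent expansion `tan u = 2 ∑_{k ≥ 1} (-1)^(k-1) sin (2ku)`, which the
Riemann-Lebesgue lemma justifies since the polynomial vanishes at the pole `π/2` of `tan`, and
integrate by parts until the polynomial is used up. The powers of `1/(2k)` sum to zeta values, and
the derivatives of the polynomial at `0` and `π/2` are the binomial coefficients times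
`± t({2}^(r+s+1-k))`.
-/

open Filter MeasureTheory Polynomial Real Set
open scoped ENNReal Nat Topology

/-! ### Tails of multiple `t`-values -/

/-- The tuples of integers with `N < k₁ < ⋯ < k_l`, so that `IncreasingTupleAbove 0 l` unfolds to
`IncreasingTuple l`. They are the ranges of summation of the inner sums of a multiple `t`-value. -/
def IncreasingTupleAbove (N l : ℕ) : Type :=
  {k : Fin l → ℕ // (∀ i, N < k i) ∧ StrictMono k}

/-- Splitting off the smallest entry `N + i + 1` of an increasing tuple above `N`. -/
noncomputable def IncreasingTupleAbove.consEquiv (N l : ℕ) :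
    (Σ i : ℕ, IncreasingTupleAbove (N + i + 1) l) ≃ IncreasingTupleAbove N (l + 1) :=
  Equiv.ofBijective
    (fun x => ⟨Fin.cons (N + x.1 + 1) x.2.1,
      Fin.forall_fin_succ.2 ⟨by simp only [Fin.cons_zero]; omega,
        fun i => by have := x.2.2.1 i; simp only [Fin.cons_succ]; omega⟩,
      Fin.strictMono_cons.2 x.2.2⟩) <| by
    constructor
    · rintro ⟨i, k, hk⟩ ⟨j, k', hk'⟩ h
      obtain ⟨hij, rfl⟩ : N + i + 1 = N + j + 1 ∧ k = k' :=
        (Fin.cons_inj (α := fun _ => ℕ)).1 (congrArg Subtype.val h)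
      obtain rfl : i = j := by omega
      rfl
    · rintro ⟨k, hN, hk⟩
      have hhead : N + (k 0 - (N + 1)) + 1 = k 0 := by have := hN 0; omega
      refine ⟨⟨k 0 - (N + 1), Fin.tail k, fun i => ?_,
        fun i j hij => hk (Fin.succ_lt_succ_iff.2 hij)⟩, Subtype.ext ?_⟩
      · rw [hhead]
        exact hk (Fin.succ_pos i)
      · simp only [hhead, Fin.cons_self_tail]

theorem tsum_increasingTupleAbove_succ (N l : ℕ) (f : (Fin (l + 1) → ℕ) → ℝ≥0∞) :
    ∑' k : IncreasingTupleAbove N (l + 1), f k.1 =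
      ∑' (i : ℕ) (k : IncreasingTupleAbove (N + i + 1) l), f (Fin.cons (N + i + 1) k.1) := by
  rw [← (IncreasingTupleAbove.consEquiv N l).tsum_eq, ENNReal.tsum_sigma']
  rfl

/-- The tail of a multiple `t`-value, i.e. the sum of `∏ 1 / (2kᵢ-1)^{sᵢ}` over
`N < k₁ < k₂ < ⋯`. It takes values in `[0, ∞]`, so that it needs no convergence. -/
noncomputable def tailSum (s : List ℕ) (N : ℕ) : ℝ≥0∞ :=
  ∑' k : IncreasingTupleAbove N s.length,
    ENNReal.ofReal (∏ i : Fin s.length, 1 / (2 * (k.1 i : ℝ) - 1) ^ s.get i)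

theorem tailSum_nil (N : ℕ) : tailSum [] N = 1 := by
  have : Unique (IncreasingTupleAbove N ([] : List ℕ).length) :=
    { default := ⟨Fin.elim0, fun i => i.elim0, fun i => i.elim0⟩
      uniq := fun k => Subtype.ext (funext fun i => i.elim0) }
  simp [tailSum, tsum_fintype]

theorem tailSum_cons (a : ℕ) (s : List ℕ) (N : ℕ) :
    tailSum (a :: s) N =
      ∑' i : ℕ, ENNReal.ofReal (1 / (2 * ((N + i : ℕ) : ℝ) + 1) ^ a) * tailSum s (N + i + 1) := by
  refine (tsum_increasingTupleAbove_succ N s.length fun k =>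
    ENNReal.ofReal (∏ i, 1 / (2 * (k i : ℝ) - 1) ^ (a :: s).get i)).trans (tsum_congr fun i => ?_)
  rw [tailSum, ← ENNReal.tsum_mul_left]
  refine tsum_congr fun k => ?_
  have hfirst : 2 * ((N + i : ℕ) : ℝ) + 1 = 2 * ((N + i + 1 : ℕ) : ℝ) - 1 := by push_cast; ring
  rw [← ENNReal.ofReal_mul (by positivity), hfirst, Fin.prod_univ_succ]
  rfl

theorem tTerm_nonneg (s : List ℕ) (k : IncreasingTuple s.length) : 0 ≤ tTerm s k := by
  refine Finset.prod_nonneg fun i _ => ?_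
  have hk : (1 : ℝ) ≤ k.1 i := by exact_mod_cast k.2.1 i
  have : 0 ≤ 2 * (k.1 i : ℝ) - 1 := by linarith
  positivity

theorem hasSum_tTerm_of_tailSum_eq {s : List ℕ} {x : ℝ} (hx : 0 ≤ x)
    (h : tailSum s 0 = ENNReal.ofReal x) : HasSum (tTerm s) x := by
  have htsum : ∑' k : IncreasingTuple s.length, ENNReal.ofReal (tTerm s k) = ENNReal.ofReal x := h
  have hne := htsum ▸ ENNReal.ofReal_ne_top
  have hsum := ENNReal.hasSum_toReal hne
  rw [← ENNReal.tsum_toReal_eq fun _ => ENNReal.ofReal_ne_top, htsum, ENNReal.toReal_ofReal hx]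
    at hsum
  simpa only [ENNReal.toReal_ofReal (tTerm_nonneg s _)] using hsum

/-! ### Cosine kernels -/

/-- The Wallis integral, by which `cosMean` is normalised. -/
noncomputable def cosMoment (n : ℕ) : ℝ := ∫ x in (0 : ℝ)..π / 2, cos x ^ n

theorem cosMoment_pos (n : ℕ) : 0 < cosMoment n := EulerSine.integral_cos_pow_pos n

theorem cosMoment_add_two (n : ℕ) : cosMoment (n + 2) = (n + 1) / (n + 2) * cosMoment n := by
  simp [cosMoment, integral_cos_pow]

theorem integral_cos_pow_mul_by_parts {p q s : ℝ → ℝ} (hp : ∀ x, HasDerivAt p (q x) x)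
    (hq : ∀ x, HasDerivAt q (s x) x) (hs : Continuous s) (n : ℕ) (ψ : ℝ) :
    (n + 2) * (n + 1) * (∫ t in ψ..π / 2, cos t ^ n * p t)
        - (n + 2) ^ 2 * (∫ t in ψ..π / 2, cos t ^ (n + 2) * p t)
      = (∫ t in ψ..π / 2, cos t ^ (n + 2) * s t)
        + (n + 2) * cos ψ ^ (n + 1) * sin ψ * p ψ + cos ψ ^ (n + 2) * q ψ := by
  have hpc : Continuous p := continuous_iff_continuousAt.2 fun x => (hp x).continuousAt
  have hderiv : ∀ x ∈ uIcc ψ (π / 2),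
      HasDerivAt (fun x => -((n + 2) * cos x ^ (n + 1) * sin x * p x) - cos x ^ (n + 2) * q x)
        ((n + 2) * (n + 1) * (cos x ^ n * p x) - (n + 2) ^ 2 * (cos x ^ (n + 2) * p x)
          - cos x ^ (n + 2) * s x) x := by
    intro x _
    refine (((((hasDerivAt_cos x).pow (n + 1)).const_mul ((n : ℝ) + 2)).mul
      (hasDerivAt_sin x)).mul (hp x)).neg.sub (((hasDerivAt_cos x).pow (n + 2)).mul (hq x))
      |>.congr_deriv ?_
    simp only [Pi.mul_apply, Pi.pow_apply, Nat.add_sub_cancel, show n + 2 - 1 = n + 1 by omega]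
    push_cast
    linear_combination ((n : ℝ) + 2) * (n + 1) * cos x ^ n * p x * sin_sq_add_cos_sq x
  have hftc := intervalIntegral.integral_eq_sub_of_hasDerivAt hderiv
    (Continuous.intervalIntegrable (by fun_prop) _ _)
  rw [intervalIntegral.integral_sub, intervalIntegral.integral_sub,
    intervalIntegral.integral_const_mul, intervalIntegral.integral_const_mul, cos_pi_div_two,
    zero_pow n.succ_ne_zero, zero_pow (n + 1).succ_ne_zero] at hftc
  · linear_combination hftc
  all_goals exact Continuous.intervalIntegrable (by fun_prop) _ _

theorem integral_cos_mul_by_parts {p q s : ℝ → ℝ} (hp : ∀ x, HasDerivAt p (q x) x)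
    (hq : ∀ x, HasDerivAt q (s x) x) (hs : Continuous s) (ψ : ℝ) :
    (∫ t in ψ..π / 2, cos t * p t) + (∫ t in ψ..π / 2, cos t * s t)
      = p (π / 2) - sin ψ * p ψ - cos ψ * q ψ := by
  have hpc : Continuous p := continuous_iff_continuousAt.2 fun x => (hp x).continuousAt
  have hderiv : ∀ x ∈ uIcc ψ (π / 2),
      HasDerivAt (fun x => sin x * p x + cos x * q x) (cos x * p x + cos x * s x) x := fun x _ =>
    (((hasDerivAt_sin x).mul (hp x)).add ((hasDerivAt_cos x).mul (hq x))).congr_deriv (by ring)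
  rw [← intervalIntegral.integral_add, intervalIntegral.integral_eq_sub_of_hasDerivAt hderiv,
    cos_pi_div_two, sin_pi_div_two]
  · ring
  all_goals exact Continuous.intervalIntegrable (by fun_prop) _ _

/-- The integral of `p` over `[ψ, π/2]` against `cos ^ (2N-1)`, this density being normalised to
have total mass `1` on `[0, π/2]`. For `N = 0`, where it is not integrable, the value is the one
that extends the recursion `cosMean_sub_succ`: the Dirac mass at `π/2`. -/
noncomputable def cosMean (ψ : ℝ) : ℕ → (ℝ → ℝ) → ℝ
  | 0, p => p (π / 2)
  | n + 1, p => (∫ t in ψ..π / 2, cos t ^ (2 * n + 1) * p t) / cosMoment (2 * n + 1)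

theorem cosMean_sub_succ {p q s : ℝ → ℝ} (hp : ∀ x, HasDerivAt p (q x) x)
    (hq : ∀ x, HasDerivAt q (s x) x) (hs : Continuous s) {ψ : ℝ} (hψ : p ψ = 0) (N : ℕ) :
    cosMean ψ N p - cosMean ψ (N + 1) p =
      1 / (2 * N + 1) ^ 2 *
        (cosMean ψ (N + 1) s + cos ψ ^ (2 * N + 1) / cosMoment (2 * N + 1) * q ψ) := by
  cases N with
  | zero =>
    have hparts := integral_cos_mul_by_parts hp hq hs ψ
    have hmass : cosMoment 1 = 1 := by simp [cosMoment]
    simp only [cosMean, mul_zero, zero_add, pow_one, hmass, div_one, Nat.cast_zero, one_pow]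
    linear_combination sin ψ * hψ - hparts
  | succ n =>
    have hparts := integral_cos_pow_mul_by_parts hp hq hs (2 * n + 1) ψ
    have hmass := cosMoment_add_two (2 * n + 1)
    have hpos := (cosMoment_pos (2 * n + 1)).ne'
    simp only [cosMean, show 2 * (n + 1) + 1 = 2 * n + 1 + 2 by ring, hmass]
    push_cast at hparts ⊢
    rw [hψ] at hparts
    set m : ℝ := 2 * n + 1 with hm
    have hm1 : m + 1 ≠ 0 := by positivity
    have hm2 : m + 2 ≠ 0 := by positivity
    rw [show 2 * ((n : ℝ) + 1) + 1 = m + 2 by rw [hm]; ring]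
    field_simp
    linear_combination hparts

theorem tendsto_cosMean {p : ℝ → ℝ} (hp : ContinuousOn p (Icc 0 (π / 2))) :
    Tendsto (fun N => cosMean 0 N p) atTop (𝓝 (p 0)) := by
  have hpeak := (EulerSine.tendsto_integral_cos_pow_mul_div (f := fun x => (p x : ℂ))
    (Complex.continuous_ofReal.comp_continuousOn hp)).comp
    (tendsto_atTop_mono (fun n => by omega : ∀ n : ℕ, n ≤ 2 * n + 1) tendsto_id)
  rw [← tendsto_add_atTop_iff_nat 1]
  refine tendsto_ofReal_iff.1 (hpeak.congr fun n => ?_)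
  simp only [Function.comp_apply, cosMean, cosMoment]
  push_cast [← intervalIntegral.integral_ofReal]
  rfl

/-- The mean `cosMean ψ N` of `t ↦ (t - ψ) ^ j / j!`. For `ψ = 0` and `j = 2s` these are the tails
of `t({2}^s)`; as functions of `ψ` they are the kernels that represent the tails of `T(r,s)`. -/
noncomputable def cosKernel (j N : ℕ) (ψ : ℝ) : ℝ := cosMean ψ N fun t => (t - ψ) ^ j / j !

theorem cosKernel_zero_right (j : ℕ) (ψ : ℝ) : cosKernel j 0 ψ = (π / 2 - ψ) ^ j / j ! := rfl

theorem cosKernel_zero_left (N : ℕ) : cosKernel 0 N 0 = 1 := by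
  cases N with
  | zero => simp [cosKernel, cosMean]
  | succ n =>
    have hmass : cosMoment (2 * n + 1) / cosMoment (2 * n + 1) = 1 :=
      div_self (cosMoment_pos _).ne'
    simpa [cosKernel, cosMean, cosMoment] using hmass

theorem hasDerivAt_sub_pow_div_factorial (j : ℕ) (ψ t : ℝ) :
    HasDerivAt (fun x => (x - ψ) ^ (j + 1) / ((j + 1)! : ℝ)) ((t - ψ) ^ j / j !) t := by
  refine ((((hasDerivAt_id t).sub_const ψ).pow (j + 1)).div_const ((j + 1)! : ℝ)).congr_deriv ?_
  have : (j ! : ℝ) ≠ 0 := by positivity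
  simp only [id, Nat.add_sub_cancel, Nat.factorial_succ]
  push_cast
  field_simp

theorem cosKernel_add_two_sub_succ (j N : ℕ) (ψ : ℝ) :
    cosKernel (j + 2) N ψ - cosKernel (j + 2) (N + 1) ψ
      = 1 / (2 * N + 1) ^ 2 * cosKernel j (N + 1) ψ := by
  have h := cosMean_sub_succ (hasDerivAt_sub_pow_div_factorial (j + 1) ψ)
    (hasDerivAt_sub_pow_div_factorial j ψ) (by fun_prop) (ψ := ψ) (by simp) N
  simpa [cosKernel] using h

theorem cosKernel_one_sub_succ (N : ℕ) (ψ : ℝ) :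
    cosKernel 1 N ψ - cosKernel 1 (N + 1) ψ
      = 1 / (2 * N + 1) ^ 2 * (cos ψ ^ (2 * N + 1) / cosMoment (2 * N + 1)) := by
  have h := cosMean_sub_succ (s := 0) (hasDerivAt_sub_pow_div_factorial 0 ψ)
    (fun x => by simpa using hasDerivAt_const x (1 : ℝ)) continuous_zero (ψ := ψ) (by simp) N
  simpa [cosKernel, cosMean] using h

theorem cos_nonneg_of_mem_Icc_zero {t : ℝ} (ht : t ∈ Icc 0 (π / 2)) : 0 ≤ cos t :=
  cos_nonneg_of_mem_Icc ⟨by linarith [ht.1, pi_pos], ht.2⟩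

theorem cosKernel_nonneg (j N : ℕ) {ψ : ℝ} (hψ : ψ ∈ Icc 0 (π / 2)) : 0 ≤ cosKernel j N ψ := by
  cases N with
  | zero => exact div_nonneg (pow_nonneg (sub_nonneg.2 hψ.2) j) (by positivity)
  | succ n =>
    refine div_nonneg (intervalIntegral.integral_nonneg hψ.2 fun t ht => ?_) (cosMoment_pos _).le
    have hcos := cos_nonneg_of_mem_Icc_zero ⟨hψ.1.trans ht.1, ht.2⟩
    have hsub : 0 ≤ t - ψ := sub_nonneg.2 ht.1
    positivity

theorem cosKernel_succ_le_cosKernel_zero (j n : ℕ) {ψ : ℝ} (hψ : ψ ∈ Icc 0 (π / 2)) :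
    cosKernel j (n + 1) ψ ≤ cosKernel j (n + 1) 0 := by
  refine div_le_div_of_nonneg_right ?_ (cosMoment_pos _).le
  have hint (a b c : ℝ) :
      IntervalIntegrable (fun t => cos t ^ (2 * n + 1) * ((t - c) ^ j / (j ! : ℝ))) volume a b :=
    Continuous.intervalIntegrable (by fun_prop) _ _
  calc ∫ t in ψ..π / 2, cos t ^ (2 * n + 1) * ((t - ψ) ^ j / (j ! : ℝ))
      ≤ ∫ t in ψ..π / 2, cos t ^ (2 * n + 1) * ((t - 0) ^ j / (j ! : ℝ)) := by
        refine intervalIntegral.integral_mono_on hψ.2 (hint _ _ _) (hint _ _ _) fun t ht => ?_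
        have hcos := cos_nonneg_of_mem_Icc_zero ⟨hψ.1.trans ht.1, ht.2⟩
        have hsub : 0 ≤ t - ψ := sub_nonneg.2 ht.1
        gcongr
        exact hψ.1
    _ ≤ ∫ t in (0 : ℝ)..π / 2, cos t ^ (2 * n + 1) * ((t - 0) ^ j / (j ! : ℝ)) := by
        refine intervalIntegral.integral_mono_interval hψ.1 hψ.2 le_rfl
          ((ae_restrict_iff' measurableSet_Ioc).2 (.of_forall fun t ht => ?_)) (hint _ _ _)
        have hcos := cos_nonneg_of_mem_Icc_zero (Ioc_subset_Icc_self ht)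
        have hsub : 0 ≤ t - 0 := sub_nonneg.2 ht.1.le
        exact mul_nonneg (by positivity) (by positivity)

theorem tendsto_cosKernel {j : ℕ} (hj : j ≠ 0) {ψ : ℝ} (hψ : ψ ∈ Icc 0 (π / 2)) :
    Tendsto (fun N => cosKernel j N ψ) atTop (𝓝 0) := by
  have hzero : Tendsto (fun N => cosKernel j N 0) atTop (𝓝 0) := by
    have h := tendsto_cosMean (p := fun t => (t - 0) ^ j / (j ! : ℝ)) (by fun_prop)
    simpa [cosKernel, hj] using h
  rw [← tendsto_add_atTop_iff_nat 1] at hzero ⊢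
  exact squeeze_zero (fun n => cosKernel_nonneg j (n + 1) hψ)
    (fun n => cosKernel_succ_le_cosKernel_zero j n hψ) hzero

theorem continuous_cosKernel (j N : ℕ) : Continuous (cosKernel j N) := by
  cases N with
  | zero => simp_rw [funext (cosKernel_zero_right j)]; fun_prop
  | succ n =>
    simp only [funext_iff.2 fun ψ => show cosKernel j (n + 1) ψ = _ / _ from rfl,
      intervalIntegral.integral_symm (π / 2)]
    exact (intervalIntegral.continuous_parametric_intervalIntegral_of_continuous
      (f := fun ψ t => cos t ^ (2 * n + 1) * ((t - ψ) ^ j / (j ! : ℝ)))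
      (by unfold Function.uncurry; fun_prop) continuous_id).neg.div_const _

theorem tsum_ofReal_of_telescoping {K f : ℕ → ℝ} (hf : ∀ n, 0 ≤ f n)
    (h : ∀ n, K n - K (n + 1) = f n) (hK : Tendsto K atTop (𝓝 0)) (N : ℕ) :
    ∑' i, ENNReal.ofReal (f (N + i)) = ENNReal.ofReal (K N) := by
  have hsum : HasSum (fun i => f (N + i)) (K N) := by
    rw [hasSum_iff_tendsto_nat_of_nonneg fun i => hf _]
    have hpartial (n : ℕ) : ∑ i ∈ Finset.range n, f (N + i) = K N - K (n + N) := by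
      simp_rw [← h, add_assoc, add_comm n N]
      exact Finset.sum_range_sub' (fun i => K (N + i)) n
    simpa [hpartial] using ((tendsto_add_atTop_iff_nat N).2 hK).const_sub (K N)
  rw [← ENNReal.ofReal_tsum_of_nonneg (fun i => hf _) hsum.summable, hsum.tsum_eq]

theorem tailSum_twos (s N : ℕ) :
    tailSum (twos s) N = ENNReal.ofReal (cosKernel (2 * s) N 0) := by
  have hzero : (0 : ℝ) ∈ Icc 0 (π / 2) := ⟨le_rfl, by positivity⟩
  induction s generalizing N with
  | zero => simp [twos, tailSum_nil, cosKernel_zero_left]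
  | succ s ih =>
    rw [mul_add, mul_one, ← tsum_ofReal_of_telescoping
      (fun n => mul_nonneg (by positivity) (cosKernel_nonneg _ _ hzero))
      (cosKernel_add_two_sub_succ (2 * s) · 0) (tendsto_cosKernel (by omega) hzero),
      show twos (s + 1) = 2 :: twos s from rfl, tailSum_cons]
    refine tsum_congr fun i => ?_
    rw [ih, ← ENNReal.ofReal_mul (by positivity)]

theorem hasSum_tTerm_twos (d : ℕ) :
    HasSum (tTerm (twos d)) ((π / 2) ^ (2 * d) / (2 * d)!) :=
  hasSum_tTerm_of_tailSum_eq (by positivity) (by rw [tailSum_twos, cosKernel_zero_right, sub_zero])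

theorem tsum_mul_lintegral_of_telescoping {α : Type*} [MeasurableSpace α] {μ : Measure α}
    {g : α → ℝ≥0∞} {K f : ℕ → α → ℝ} {c : ℕ → ℝ} (hg : Measurable g)
    (hfm : ∀ n, Measurable (f n)) (hc : ∀ n, 0 ≤ c n) (hf : ∀ᵐ a ∂μ, ∀ n, 0 ≤ f n a)
    (hK : ∀ n a, K n a - K (n + 1) a = c n * f n a)
    (hlim : ∀ᵐ a ∂μ, Tendsto (K · a) atTop (𝓝 0)) (N : ℕ) :
    ∑' i, ENNReal.ofReal (c (N + i)) * ∫⁻ a, g a * ENNReal.ofReal (f (N + i) a) ∂μ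
      = ∫⁻ a, g a * ENNReal.ofReal (K N a) ∂μ := by
  have hmeas (i : ℕ) : Measurable fun a => g a * ENNReal.ofReal (f (N + i) a) :=
    hg.mul (hfm (N + i)).ennreal_ofReal
  rw [tsum_congr fun i => (lintegral_const_mul (ENNReal.ofReal (c (N + i))) (hmeas i)).symm,
    ← lintegral_tsum fun i => ((hmeas i).const_mul _).aemeasurable]
  refine lintegral_congr_ae ?_
  filter_upwards [hf, hlim] with a hfa hlima
  rw [← tsum_ofReal_of_telescoping (fun n => mul_nonneg (hc n) (hfa n)) (hK · a) hlima,
    ← ENNReal.tsum_mul_left]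
  refine tsum_congr fun i => ?_
  rw [ENNReal.ofReal_mul (hc _), mul_left_comm]

theorem integral_cos_pow_succ_mul_deriv {p q : ℝ → ℝ} (hp : ∀ x, HasDerivAt p (q x) x)
    (hq : Continuous q) (h0 : p 0 = 0) (n : ℕ) :
    ∫ t in (0 : ℝ)..π / 2, cos t ^ (n + 1) * q t =
      (n + 1) * ∫ t in (0 : ℝ)..π / 2, cos t ^ n * sin t * p t := by
  have hcos (x : ℝ) :
      HasDerivAt (fun x => cos x ^ (n + 1)) (-((n + 1) * (cos x ^ n * sin x))) x := by
    refine ((hasDerivAt_cos x).pow (n + 1)).congr_deriv ?_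
    simp only [Nat.add_sub_cancel]
    push_cast
    ring
  rw [intervalIntegral.integral_mul_deriv_eq_deriv_mul (fun x _ => hcos x) (fun x _ => hp x)
    (Continuous.intervalIntegrable (by fun_prop) _ _) (hq.intervalIntegrable _ _), h0,
    cos_pi_div_two, zero_pow n.succ_ne_zero, ← intervalIntegral.integral_const_mul, zero_mul,
    mul_zero, sub_zero, zero_sub, ← intervalIntegral.integral_neg]
  simp only [neg_mul, neg_neg, mul_assoc]

theorem tan_mul_pow_div_nonneg (j : ℕ) {ψ : ℝ} (hψ : ψ ∈ Ioo 0 (π / 2)) :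
    0 ≤ tan ψ * (ψ ^ j / j !) := by
  have htan := tan_nonneg_of_nonneg_of_le_pi_div_two hψ.1.le hψ.2.le
  have hpos := hψ.1
  positivity

theorem cos_pow_div_cosMoment_nonneg (n : ℕ) {ψ : ℝ} (hψ : ψ ∈ Icc 0 (π / 2)) :
    0 ≤ cos ψ ^ n / cosMoment n :=
  div_nonneg (pow_nonneg (cos_nonneg_of_mem_Icc_zero hψ) n) (cosMoment_pos n).le

-- Integrating by parts turns the third factor `1 / (2k-1)` of the entry `3` into `tan ψ`.
theorem ofReal_cosKernel_succ_div (j n : ℕ) :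
    ENNReal.ofReal (cosKernel j (n + 1) 0 / (2 * n + 1)) =
      ∫⁻ ψ in Ioo 0 (π / 2), ENNReal.ofReal (tan ψ * (ψ ^ (j + 1) / (j + 1)!)) *
        ENNReal.ofReal (cos ψ ^ (2 * n + 1) / cosMoment (2 * n + 1)) := by
  have hparts := integral_cos_pow_succ_mul_deriv (hasDerivAt_sub_pow_div_factorial j 0)
    (by fun_prop) (by simp) (2 * n)
  have hn : (2 * n + 1 : ℝ) ≠ 0 := by positivity
  push_cast at hparts
  have hintegrand : ∀ ψ ∈ Ioo 0 (π / 2),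
      cos ψ ^ (2 * n) * sin ψ * ((ψ - 0) ^ (j + 1) / (j + 1)!) / cosMoment (2 * n + 1) =
        tan ψ * (ψ ^ (j + 1) / (j + 1)!) * (cos ψ ^ (2 * n + 1) / cosMoment (2 * n + 1)) := by
    intro ψ hψ
    have hcos := (cos_pos_of_mem_Ioo ⟨by linarith [hψ.1, pi_pos], hψ.2⟩).ne'
    rw [sub_zero, tan_eq_sin_div_cos, pow_succ (cos ψ)]
    field_simp
  rw [cosKernel, cosMean, hparts, div_right_comm, mul_div_cancel_left₀ _ hn,
    ← intervalIntegral.integral_div, intervalIntegral.integral_of_le (by positivity),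
    integral_Ioc_eq_integral_Ioo, ofReal_integral_eq_lintegral_ofReal]
  · refine setLIntegral_congr_fun measurableSet_Ioo fun ψ hψ => ?_
    rw [hintegrand ψ hψ, ENNReal.ofReal_mul (tan_mul_pow_div_nonneg _ hψ)]
  · exact (Continuous.integrableOn_Icc (by fun_prop)).mono_set Ioo_subset_Icc_self
  · filter_upwards [self_mem_ae_restrict measurableSet_Ioo] with ψ hψ
    rw [hintegrand ψ hψ]
    exact mul_nonneg (tan_mul_pow_div_nonneg _ hψ)
      (cos_pow_div_cosMoment_nonneg _ (Ioo_subset_Icc_self hψ))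

theorem measurable_ofReal_tan_mul_pow (j : ℕ) :
    Measurable fun ψ : ℝ => ENNReal.ofReal (tan ψ * (ψ ^ j / j !)) := by
  simp_rw [tan_eq_sin_div_cos]
  fun_prop

theorem tailSum_three_twos (s N : ℕ) :
    tailSum (3 :: twos s) N = ∫⁻ ψ in Ioo 0 (π / 2),
      ENNReal.ofReal (tan ψ * (ψ ^ (2 * s + 1) / (2 * s + 1)!)) *
        ENNReal.ofReal (cosKernel 1 N ψ) := by
  have hmem : ∀ᵐ ψ ∂volume.restrict (Ioo 0 (π / 2)), ψ ∈ Ioo 0 (π / 2) :=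
    ae_restrict_mem measurableSet_Ioo
  rw [← tsum_mul_lintegral_of_telescoping (measurable_ofReal_tan_mul_pow _)
    (fun n => by fun_prop) (fun n => by positivity)
    (hmem.mono fun ψ hψ n => cos_pow_div_cosMoment_nonneg _ (Ioo_subset_Icc_self hψ))
    cosKernel_one_sub_succ
    (hmem.mono fun ψ hψ => tendsto_cosKernel one_ne_zero (Ioo_subset_Icc_self hψ)), tailSum_cons]
  refine tsum_congr fun i => ?_
  rw [← ofReal_cosKernel_succ_div, tailSum_twos, ← ENNReal.ofReal_mul (by positivity),
    ← ENNReal.ofReal_mul (by positivity)]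
  congr 1
  field_simp

theorem tailSum_twosThreeTwos (r s N : ℕ) :
    tailSum (twosThreeTwos r s) N = ∫⁻ ψ in Ioo 0 (π / 2),
      ENNReal.ofReal (tan ψ * (ψ ^ (2 * s + 1) / (2 * s + 1)!)) *
        ENNReal.ofReal (cosKernel (2 * r + 1) N ψ) := by
  have hmem : ∀ᵐ ψ ∂volume.restrict (Ioo 0 (π / 2)), ψ ∈ Ioo 0 (π / 2) :=
    ae_restrict_mem measurableSet_Ioo
  induction r generalizing N with
  | zero => exact tailSum_three_twos s N
  | succ r ih =>
    rw [show 2 * (r + 1) + 1 = 2 * r + 1 + 2 by ring,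
      ← tsum_mul_lintegral_of_telescoping (measurable_ofReal_tan_mul_pow _)
      (fun n => (continuous_cosKernel _ _).measurable) (fun n => by positivity)
      (hmem.mono fun ψ hψ n => cosKernel_nonneg _ _ (Ioo_subset_Icc_self hψ))
      (cosKernel_add_two_sub_succ (2 * r + 1))
      (hmem.mono fun ψ hψ => tendsto_cosKernel (by omega) (Ioo_subset_Icc_self hψ)),
      show twosThreeTwos (r + 1) s = 2 :: twosThreeTwos r s from rfl, tailSum_cons]
    exact tsum_congr fun i => by rw [ih]

/-! ### Integrals of polynomials against the tangent -/

theorem integral_eval_mul_sin_eq_sub (P : ℝ[X]) {c w : ℝ} (hw : w ≠ 0) (hc : sin (w * c) = 0) :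
    ∫ u in (0 : ℝ)..c, P.eval u * sin (w * u) =
      (P.eval 0 - cos (w * c) * P.eval c) / w
        - 1 / w ^ 2 * ∫ u in (0 : ℝ)..c, (derivative^[2] P).eval u * sin (w * u) := by
  have hderiv : ∀ u ∈ uIcc 0 c, HasDerivAt
      (fun u => -(P.eval u * cos (w * u) / w) + (derivative P).eval u * sin (w * u) / w ^ 2)
      (P.eval u * sin (w * u)
        + 1 / w ^ 2 * ((derivative^[2] P).eval u * sin (w * u))) u := by
    intro u _
    have hlin : HasDerivAt (w * ·) w u := by simpa using (hasDerivAt_id u).const_mul w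
    refine ((((P.hasDerivAt u).mul hlin.cos).div_const w).neg.add
      ((((derivative P).hasDerivAt u).mul hlin.sin).div_const (w ^ 2))).congr_deriv ?_
    simp only [Function.iterate_succ_apply, Function.iterate_zero_apply]
    field_simp
    ring
  have hftc := intervalIntegral.integral_eq_sub_of_hasDerivAt hderiv
    (Continuous.intervalIntegrable (by fun_prop) _ _)
  rw [intervalIntegral.integral_add (Continuous.intervalIntegrable (by fun_prop) _ _)
    (Continuous.intervalIntegrable (by fun_prop) _ _), intervalIntegral.integral_const_mul,
    hc, mul_zero w, cos_zero, sin_zero] at hftc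
  rw [eq_sub_iff_add_eq, hftc]
  ring

theorem integral_eval_mul_sin {d : ℕ} {P : ℝ[X]} (hP : derivative^[2 * d] P = 0) {c w : ℝ}
    (hw : w ≠ 0) (hc : sin (w * c) = 0) :
    ∫ u in (0 : ℝ)..c, P.eval u * sin (w * u) =
      ∑ j ∈ Finset.range d, (-1) ^ j * ((derivative^[2 * j] P).eval 0
        - cos (w * c) * (derivative^[2 * j] P).eval c) / w ^ (2 * j + 1) := by
  induction d generalizing P with
  | zero =>
    obtain rfl : P = 0 := hP
    simp
  | succ d ih =>
    have hiter (j : ℕ) : derivative^[2 * j] (derivative^[2] P) = derivative^[2 * (j + 1)] P := by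
      rw [← Function.iterate_add_apply, mul_add, mul_one]
    rw [integral_eval_mul_sin_eq_sub P hw hc, ih (by rw [hiter, hP]), Finset.sum_range_succ',
      sub_eq_neg_add, Finset.mul_sum, ← Finset.sum_neg_distrib]
    congr 1
    · refine Finset.sum_congr rfl fun j _ => ?_
      rw [hiter]
      field_simp
      ring
    · simp

theorem sum_neg_one_pow_mul_sin_mul_cos (n : ℕ) (u : ℝ) :
    (∑ k ∈ Finset.range n, (-1) ^ k * (2 * sin (2 * (k + 1) * u))) * cos u
      = sin u - (-1) ^ n * sin ((2 * n + 1) * u) := by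
  induction n with
  | zero => simp
  | succ n ih =>
    have hminus : (2 * n + 1) * u = 2 * (n + 1) * u - u := by ring
    have hplus : (2 * ((n + 1 : ℕ) : ℝ) + 1) * u = 2 * (n + 1) * u + u := by push_cast; ring
    rw [Finset.sum_range_succ, add_mul, ih, hminus, hplus, sin_sub, sin_add]
    ring

theorem tendsto_integral_mul_sin_cocompact {f : ℝ → ℝ} (hf : Integrable f) :
    Tendsto (fun w : ℝ => ∫ v, f v * sin (w * v)) (cocompact ℝ) (𝓝 0) := by
  have hscale : Tendsto (fun w : ℝ => w * -(2 * π)⁻¹) (cocompact ℝ) (cocompact ℝ) :=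
    (Homeomorph.mulRight₀ (-(2 * π)⁻¹)
      (neg_ne_zero.2 (by positivity))).isClosedEmbedding.tendsto_cocompact
  have hfourier := (Complex.continuous_im.tendsto 0).comp
    ((Real.tendsto_integral_exp_smul_cocompact fun v => (f v : ℂ)).comp hscale)
  refine hfourier.congr fun w => ?_
  have hint : Integrable fun v => Real.fourierChar (-(v * (w * -(2 * π)⁻¹))) • (f v : ℂ) := by
    simpa [mul_comm] using
      (Real.fourierIntegral_convergent_iff (w * -(2 * π)⁻¹)).2 (hf.ofReal (𝕜 := ℂ))
  rw [Function.comp_apply, Function.comp_apply, ← Complex.imCLM_apply,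
    ← ContinuousLinearMap.integral_comp_comm _ hint]
  refine integral_congr_ae (.of_forall fun v => ?_)
  have harg : 2 * π * -(v * (w * -(2 * π)⁻¹)) = w * v := by field_simp
  simp only [Complex.imCLM_apply, Circle.smul_def, Real.fourierChar_apply, smul_eq_mul,
    Complex.im_mul_ofReal, harg, Complex.exp_ofReal_mul_I_im, mul_comm (f v)]

theorem tendsto_intervalIntegral_mul_sin_odd {g : ℝ → ℝ} {a b : ℝ} (hab : a ≤ b)
    (hg : IntervalIntegrable g volume a b) :
    Tendsto (fun n : ℕ => ∫ u in a..b, g u * sin ((2 * n + 1) * u)) atTop (𝓝 0) := by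
  have hodd : Tendsto (fun n : ℕ => 2 * (n : ℝ) + 1) atTop (cocompact ℝ) :=
    (tendsto_atTop_add_const_right _ _
      (tendsto_natCast_atTop_atTop.const_mul_atTop two_pos)).mono_right atTop_le_cocompact
  have hind : Integrable ((Ioc a b).indicator g) :=
    (integrable_indicator_iff measurableSet_Ioc).2
      ((intervalIntegrable_iff_integrableOn_Ioc_of_le hab).1 hg)
  refine ((tendsto_integral_mul_sin_cocompact hind).comp hodd).congr fun n => ?_
  rw [intervalIntegral.integral_of_le hab, ← integral_indicator measurableSet_Ioc]
  simp only [Function.comp_apply, indicator_mul_left]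

theorem intervalIntegrable_eval_div_cos {P : ℝ[X]} (hP : P.eval (π / 2) = 0) :
    IntervalIntegrable (fun u => P.eval u / cos u) volume 0 (π / 2) := by
  obtain ⟨R, rfl⟩ : X - C (π / 2) ∣ P := dvd_iff_isRoot.2 hP
  have hpi : (0 : ℝ) ≤ π / 2 := by positivity
  have hsinc : ∀ u ∈ Icc 0 (π / 2), sinc (π / 2 - u) ≠ 0 := fun u hu => by
    rcases eq_or_ne (π / 2 - u) 0 with h | h
    · simp [h]
    · rw [sinc_of_ne_zero h]
      have := lt_of_le_of_ne (sub_nonneg.2 hu.2) h.symm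
      exact (div_pos (sin_pos_of_mem_Ioo ⟨this, by linarith [hu.1, pi_pos]⟩) this).ne'
  have hcont : IntervalIntegrable (fun u => -(R.eval u / sinc (π / 2 - u))) volume 0 (π / 2) := by
    refine ContinuousOn.intervalIntegrable ?_
    rw [uIcc_of_le hpi]
    exact (ContinuousOn.div (by fun_prop) (by fun_prop) hsinc).neg
  refine hcont.congr_uIoo fun u hu => ?_
  rw [uIoo_of_le hpi] at hu
  have hne : π / 2 - u ≠ 0 := (sub_pos.2 hu.2).ne'
  simp only [eval_mul, eval_sub, eval_X, eval_C, sinc_of_ne_zero hne, sin_pi_div_two_sub,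
    div_div_eq_mul_div]
  ring

theorem sum_integral_eval_mul_sin {P : ℝ[X]} (hP : P.eval (π / 2) = 0) (n : ℕ) :
    ∑ k ∈ Finset.range n,
        (-1) ^ k * (2 * ∫ u in (0 : ℝ)..π / 2, P.eval u * sin (2 * (k + 1) * u)) =
      (∫ u in (0 : ℝ)..π / 2, P.eval u * tan u)
        - (-1) ^ n * ∫ u in (0 : ℝ)..π / 2, P.eval u / cos u * sin ((2 * n + 1) * u) := by
  have hint := intervalIntegrable_eval_div_cos hP
  simp_rw [tan_eq_sin_div_cos, ← mul_div_assoc, ← div_mul_eq_mul_div,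
    ← intervalIntegral.integral_const_mul]
  rw [← intervalIntegral.integral_finsetSum
      fun k _ => Continuous.intervalIntegrable (by fun_prop) _ _,
    ← intervalIntegral.integral_sub (hint.mul_continuousOn (by fun_prop))
      ((hint.mul_continuousOn (by fun_prop)).const_mul _)]
  refine intervalIntegral.integral_congr_Ioo_of_le (by positivity) fun u hu => ?_
  have hcos : cos u ≠ 0 := (cos_pos_of_mem_Ioo ⟨by linarith [hu.1, pi_pos], hu.2⟩).ne'
  calc ∑ k ∈ Finset.range n, (-1) ^ k * (2 * (P.eval u * sin (2 * (k + 1) * u)))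
      = P.eval u / cos u *
          ((∑ k ∈ Finset.range n, (-1) ^ k * (2 * sin (2 * (k + 1) * u))) * cos u) := by
        rw [mul_comm _ (cos u), ← mul_assoc, div_mul_cancel₀ _ hcos, Finset.mul_sum]
        exact Finset.sum_congr rfl fun k _ => by ring
    _ = _ := by rw [sum_neg_one_pow_mul_sin_mul_cos]; ring

theorem tendsto_sum_integral_eval_mul_sin {P : ℝ[X]} (hP : P.eval (π / 2) = 0) :
    Tendsto (fun n : ℕ => ∑ k ∈ Finset.range n,
        (-1) ^ k * (2 * ∫ u in (0 : ℝ)..π / 2, P.eval u * sin (2 * (k + 1) * u)))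
      atTop (𝓝 (∫ u in (0 : ℝ)..π / 2, P.eval u * tan u)) := by
  have hsign : IsBoundedUnder (· ≤ ·) atTop (norm ∘ fun n : ℕ => (-1 : ℝ) ^ n) :=
    isBoundedUnder_of ⟨1, by simp⟩
  have herror := isBoundedUnder_le_mul_tendsto_zero hsign
    (tendsto_intervalIntegral_mul_sin_odd (by positivity) (intervalIntegrable_eval_div_cos hP))
  simpa only [sum_integral_eval_mul_sin hP, sub_zero] using herror.const_sub _

theorem summable_one_div_succ_pow {p : ℕ} (hp : 1 < p) :
    Summable fun k : ℕ => 1 / ((k : ℝ) + 1) ^ p := by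
  exact_mod_cast (summable_nat_add_iff 1).2 (Real.summable_one_div_nat_pow.2 hp)

theorem ofReal_tsum_one_div_succ_pow {p : ℕ} (hp : 1 < p) :
    ((∑' k : ℕ, 1 / ((k : ℝ) + 1) ^ p : ℝ) : ℂ) = riemannZeta p := by
  rw [zeta_eq_tsum_one_div_nat_add_one_cpow (by simpa using hp), Complex.ofReal_tsum]
  exact tsum_congr fun k => by push_cast; rw [Complex.cpow_natCast]

theorem hasSum_neg_one_pow_div_succ_pow {p : ℕ} (hp : p ≠ 0) :
    HasSum (fun k : ℕ => (-1) ^ k / ((k : ℝ) + 1) ^ (p + 1))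
      ((1 - 1 / 2 ^ p) * ∑' k : ℕ, 1 / ((k : ℝ) + 1) ^ (p + 1)) := by
  set Z := ∑' k : ℕ, 1 / ((k : ℝ) + 1) ^ (p + 1)
  have hZ : HasSum (fun k : ℕ => 1 / ((k : ℝ) + 1) ^ (p + 1)) Z :=
    (summable_one_div_succ_pow (by omega)).hasSum
  have hodd : HasSum (fun k : ℕ => 1 / (((2 * k + 1 : ℕ) : ℝ) + 1) ^ (p + 1))
      (1 / 2 ^ (p + 1) * Z) := by
    refine (hZ.mul_left (1 / 2 ^ (p + 1))).congr_fun fun k => ?_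
    rw [div_mul_div_comm, ← mul_pow]
    push_cast
    congr 2 <;> ring
  obtain ⟨E, hE⟩ : Summable fun k : ℕ => 1 / (((2 * k : ℕ) : ℝ) + 1) ^ (p + 1) :=
    hZ.summable.comp_injective (mul_right_injective₀ two_ne_zero)
  have hEZ : E + 1 / 2 ^ (p + 1) * Z = Z :=
    (HasSum.even_add_odd (f := fun k : ℕ => 1 / ((k : ℝ) + 1) ^ (p + 1)) hE hodd).unique hZ
  have halt := HasSum.even_add_odd (f := fun k : ℕ => (-1) ^ k / ((k : ℝ) + 1) ^ (p + 1))
    (by simpa only [even_two_mul, Even.neg_one_pow] using hE)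
    (hodd.neg.congr_fun fun k => by rw [pow_succ (-1 : ℝ), pow_mul]; simp [neg_div])
  have hvalue : (1 - 1 / 2 ^ p) * Z = E + -(1 / 2 ^ (p + 1) * Z) := by
    rw [pow_succ] at hEZ ⊢
    linear_combination -hEZ
  rwa [hvalue]

theorem two_mul_integral_eval_mul_sin {d : ℕ} {P : ℝ[X]} (hP : derivative^[2 * (d + 1)] P = 0)
    (hzero : P.eval 0 = 0) (hpi : P.eval (π / 2) = 0) (k : ℕ) :
    (-1) ^ k * (2 * ∫ u in (0 : ℝ)..π / 2, P.eval u * sin (2 * (k + 1) * u)) =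
      ∑ j ∈ Finset.Icc 1 d, (-1) ^ j / 2 ^ (2 * j) *
        ((derivative^[2 * j] P).eval (π / 2) * (1 / ((k : ℝ) + 1) ^ (2 * j + 1))
          + (derivative^[2 * j] P).eval 0 * ((-1) ^ k / ((k : ℝ) + 1) ^ (2 * j + 1))) := by
  have hangle : 2 * ((k : ℝ) + 1) * (π / 2) = (k + 1 : ℕ) * π := by push_cast; ring
  have hsign : ((-1 : ℝ) ^ k) ^ 2 = 1 := by rw [pow_right_comm, neg_one_sq, one_pow]
  rw [integral_eval_mul_sin hP (by positivity) (by rw [hangle, sin_nat_mul_pi]), hangle,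
    cos_nat_mul_pi, Finset.range_eq_Ico, Finset.sum_eq_sum_Ico_succ_bot d.succ_pos, mul_zero,
    Function.iterate_zero_apply, hzero, hpi, mul_zero, sub_zero, mul_zero, zero_div, zero_add,
    Finset.mul_sum, Finset.mul_sum]
  refine Finset.sum_congr rfl fun j _ => ?_
  rw [mul_pow, pow_succ (2 : ℝ), pow_succ (-1 : ℝ) k]
  field_simp
  linear_combination (derivative^[2 * j] P).eval (π / 2) * hsign

theorem integral_eval_mul_tan {d : ℕ} {P : ℝ[X]} (hP : derivative^[2 * (d + 1)] P = 0)
    (hzero : P.eval 0 = 0) (hpi : P.eval (π / 2) = 0) :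
    ∫ u in (0 : ℝ)..π / 2, P.eval u * tan u =
      ∑ j ∈ Finset.Icc 1 d, (-1) ^ j / 2 ^ (2 * j) * ((derivative^[2 * j] P).eval (π / 2)
        + (1 - 1 / 2 ^ (2 * j)) * (derivative^[2 * j] P).eval 0)
        * ∑' k : ℕ, 1 / ((k : ℝ) + 1) ^ (2 * j + 1) := by
  have hsum : HasSum
      (fun k : ℕ => (-1) ^ k * (2 * ∫ u in (0 : ℝ)..π / 2, P.eval u * sin (2 * (k + 1) * u)))
      (∑ j ∈ Finset.Icc 1 d, (-1) ^ j / 2 ^ (2 * j) * ((derivative^[2 * j] P).eval (π / 2)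
        + (1 - 1 / 2 ^ (2 * j)) * (derivative^[2 * j] P).eval 0)
        * ∑' k : ℕ, 1 / ((k : ℝ) + 1) ^ (2 * j + 1)) := by
    simp_rw [two_mul_integral_eval_mul_sin hP hzero hpi]
    refine hasSum_sum fun j hj => ?_
    have hj1 : 1 ≤ j := (Finset.mem_Icc.1 hj).1
    have hzeta := (summable_one_div_succ_pow (p := 2 * j + 1) (by omega)).hasSum
    have heta := hasSum_neg_one_pow_div_succ_pow (p := 2 * j) (by omega)
    have hcombined := ((hzeta.mul_left ((derivative^[2 * j] P).eval (π / 2))).add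
      (heta.mul_left ((derivative^[2 * j] P).eval 0))).mul_left ((-1) ^ j / 2 ^ (2 * j))
    rwa [← mul_assoc _ (1 - _) (tsum _), mul_comm _ (1 - _), ← add_mul, ← mul_assoc] at hcombined
  exact tendsto_nhds_unique (tendsto_sum_integral_eval_mul_sin hpi) hsum.tendsto_sum_nat

/-! ### Beta polynomials -/

/-- The polynomial `u ^ a / a! * (c - u) ^ b / b!`, the integrand of a beta integral over `[0, c]`.
It represents `T(r,s)` for `c = π / 2`, `a = 2s + 1` and `b = 2r + 1`. -/
noncomputable def betaPoly (c : ℝ) (a b : ℕ) : ℝ[X] :=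
  C (1 / ((a ! : ℝ) * b !)) * (X ^ a * (C c - X) ^ b)

theorem eval_betaPoly (c : ℝ) (a b : ℕ) (u : ℝ) :
    (betaPoly c a b).eval u = u ^ a / a ! * ((c - u) ^ b / b !) := by
  simp only [betaPoly, eval_mul, eval_C, eval_pow, eval_X, eval_sub]
  ring

theorem natDegree_betaPoly_le (c : ℝ) (a b : ℕ) : (betaPoly c a b).natDegree ≤ a + b := by
  unfold betaPoly
  compute_degree

theorem betaPoly_comp_C_sub_X (c : ℝ) (a b : ℕ) :
    (betaPoly c a b).comp (C c - X) = betaPoly c b a := by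
  simp only [betaPoly, mul_comp, C_comp, pow_comp, X_comp, sub_comp, sub_sub_cancel]
  rw [mul_comm (a ! : ℝ), mul_comm (X ^ b)]

theorem coeff_C_sub_X_pow {R : Type*} [CommRing R] (c : R) (n k : ℕ) :
    ((C c - X) ^ n).coeff k = (-1) ^ k * (c ^ (n - k) * n.choose k) := by
  have hcomp : (C c - X) ^ n = ((X + C c) ^ n).comp (C (-1) * X) := by
    simp [sub_eq_neg_add]
  rw [hcomp, comp_C_mul_X_coeff, coeff_X_add_C_pow, mul_comm]

theorem eval_zero_iterate_derivative_betaPoly (c : ℝ) {a b n : ℕ} (hn : n ≤ a + b) :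
    (derivative^[n] (betaPoly c a b)).eval 0 =
      (-1) ^ (n + a) * n.choose a * (c ^ (a + b - n) / (a + b - n)!) := by
  rw [← coeff_zero_eq_eval_zero, coeff_iterate_derivative, zero_add, Nat.descFactorial_self,
    betaPoly, coeff_C_mul, coeff_X_pow_mul', nsmul_eq_mul]
  split_ifs with ha
  · obtain ⟨i, rfl⟩ := Nat.exists_eq_add_of_le ha
    obtain ⟨e, rfl⟩ : ∃ e, b = i + e := Nat.exists_eq_add_of_le (by omega)
    have hfact : (i ! : ℝ) ≠ 0 := by positivity
    have hsign : (-1 : ℝ) ^ (a + i + a) = (-1) ^ i := by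
      rw [add_right_comm, pow_add, Even.neg_one_pow ⟨a, rfl⟩, one_mul]
    rw [coeff_C_sub_X_pow, Nat.add_sub_cancel_left, Nat.add_sub_cancel_left, ← add_assoc,
      Nat.add_sub_cancel_left, Nat.cast_add_choose, Nat.cast_add_choose, hsign]
    field_simp
  · rw [Nat.choose_eq_zero_of_lt (by omega)]
    simp

theorem iterate_derivative_comp_C_sub_X {R : Type*} [CommRing R] (c : R) (n : ℕ) (P : R[X]) :
    derivative^[n] (P.comp (C c - X)) = (-1) ^ n * (derivative^[n] P).comp (C c - X) := by
  induction n generalizing P with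
  | zero => simp
  | succ n ih => simp [ih (derivative P), derivative_comp, pow_succ]

theorem eval_iterate_derivative_betaPoly (c : ℝ) {a b n : ℕ} (hn : n ≤ a + b) :
    (derivative^[n] (betaPoly c a b)).eval c =
      (-1) ^ b * n.choose b * (c ^ (a + b - n) / (a + b - n)!) := by
  have hsign : (-1 : ℝ) ^ n * (-1) ^ (n + b) = (-1) ^ b := by
    rw [pow_add, ← mul_assoc, ← mul_pow]; simp
  rw [← betaPoly_comp_C_sub_X, iterate_derivative_comp_C_sub_X, eval_mul, eval_comp, eval_sub,
    eval_C, eval_X, sub_self, eval_zero_iterate_derivative_betaPoly c (by omega), add_comm b a,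
    ← hsign]
  simp only [eval_pow, eval_neg, eval_one]
  ring

theorem integral_betaPoly_mul_tan (r s : ℕ) :
    ∫ u in (0 : ℝ)..π / 2, (betaPoly (π / 2) (2 * s + 1) (2 * r + 1)).eval u * tan u =
      ∑ k ∈ Finset.Icc 1 (r + s + 1), (-1) ^ (k - 1) * dCoeff k r s * (1 / 2 ^ (2 * k))
        * (∑' n : ℕ, 1 / ((n : ℝ) + 1) ^ (2 * k + 1))
        * ((π / 2) ^ (2 * (r + s + 1 - k)) / (2 * (r + s + 1 - k))!) := by
  have hdeg := natDegree_betaPoly_le (π / 2) (2 * s + 1) (2 * r + 1)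
  rw [integral_eval_mul_tan (d := r + s + 1) (iterate_derivative_eq_zero (by omega))
    (by simp [eval_betaPoly]) (by simp [eval_betaPoly])]
  refine Finset.sum_congr rfl fun k hk => ?_
  obtain ⟨hk1, hk2⟩ := Finset.mem_Icc.1 hk
  obtain ⟨m, rfl⟩ := Nat.exists_eq_add_of_le' hk1
  rw [eval_zero_iterate_derivative_betaPoly _ (by omega),
    eval_iterate_derivative_betaPoly _ (by omega),
    Odd.neg_one_pow (n := 2 * (m + 1) + (2 * s + 1)) ⟨m + 1 + s, by ring⟩,
    Odd.neg_one_pow (n := 2 * r + 1) ⟨r, rfl⟩, dCoeff, Nat.add_sub_cancel, pow_succ (-1 : ℝ) m,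
    show 2 * s + 1 + (2 * r + 1) - 2 * (m + 1) = 2 * (r + s + 1 - (m + 1)) by omega]
  ring

theorem hasSum_tTerm_twosThreeTwos (r s : ℕ) :
    HasSum (tTerm (twosThreeTwos r s))
      (∫ u in (0 : ℝ)..π / 2, (betaPoly (π / 2) (2 * s + 1) (2 * r + 1)).eval u * tan u) := by
  have hpi : (0 : ℝ) ≤ π / 2 := by positivity
  set F : ℝ → ℝ := fun u => (betaPoly (π / 2) (2 * s + 1) (2 * r + 1)).eval u * tan u
  have hF (u : ℝ) : F u =
      tan u * (u ^ (2 * s + 1) / (2 * s + 1)!) * cosKernel (2 * r + 1) 0 u := by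
    simp only [F, eval_betaPoly, cosKernel_zero_right]
    ring
  have hnonneg : ∀ u ∈ Ioo 0 (π / 2), 0 ≤ F u := fun u hu => by
    rw [hF]
    exact mul_nonneg (tan_mul_pow_div_nonneg _ hu) (cosKernel_nonneg _ _ (Ioo_subset_Icc_self hu))
  have hint : IntegrableOn F (Ioo 0 (π / 2)) := by
    have := (intervalIntegrable_eval_div_cos
      (P := betaPoly (π / 2) (2 * s + 1) (2 * r + 1)) (by simp [eval_betaPoly])).mul_continuousOn
        continuous_sin.continuousOn
    rw [← intervalIntegrable_iff_integrableOn_Ioo_of_le hpi]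
    simpa only [F, tan_eq_sin_div_cos, ← mul_div_assoc, div_mul_eq_mul_div] using this
  rw [intervalIntegral.integral_of_le hpi, integral_Ioc_eq_integral_Ioo]
  refine hasSum_tTerm_of_tailSum_eq (setIntegral_nonneg measurableSet_Ioo hnonneg) ?_
  rw [tailSum_twosThreeTwos, ofReal_integral_eq_lintegral_ofReal hint
    (ae_restrict_of_forall_mem measurableSet_Ioo hnonneg)]
  refine setLIntegral_congr_fun measurableSet_Ioo fun u hu => ?_
  rw [hF, ENNReal.ofReal_mul (tan_mul_pow_div_nonneg _ hu)]

/-- Convergence of all series involved is part of the claim. -/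
theorem theorem1p2 (r s : ℕ) :
    Summable (tTerm (twosThreeTwos r s)) ∧
    (∀ k ∈ Finset.Icc 1 (r + s + 1), Summable (tTerm (twos (r + s + 1 - k)))) ∧
    (T r s : ℂ) =
      ∑ k ∈ Finset.Icc 1 (r + s + 1),
        (-1 : ℂ) ^ (k - 1) * (dCoeff k r s : ℂ) * (1 / 2 ^ (2 * k))
          * riemannZeta (2 * (k : ℂ) + 1) * (multipleT (twos (r + s + 1 - k)) : ℂ) := by
  refine ⟨(hasSum_tTerm_twosThreeTwos r s).summable,
    fun k _ => (hasSum_tTerm_twos _).summable, ?_⟩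
  rw [T, multipleT, (hasSum_tTerm_twosThreeTwos r s).tsum_eq, integral_betaPoly_mul_tan,
    Complex.ofReal_sum]
  refine Finset.sum_congr rfl fun k hk => ?_
  have hzeta := ofReal_tsum_one_div_succ_pow (p := 2 * k + 1)
    (by have := (Finset.mem_Icc.1 hk).1; omega)
  push_cast at hzeta
  rw [multipleT, (hasSum_tTerm_twos _).tsum_eq]
  push_cast
  rw [hzeta]
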